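/- Let $\Theta$ be a rational inner function on the bidisk $\mathbb{D}^2$, i.e. $\Theta = q/p$ on $\mathbb{D}^2$ for polynomials $q, p \in \mathbb{C}[z_1,z_2]$ such that $p$ has no zeros in $\mathbb{D}^2$, and the radial boundary values of $\Theta$ satisfy $|\Theta(\tau)| = 1$ for almost every $\tau \in \mathbb{T}^2$. Let $H^2(\mathbb{D}^2)$ be the Hardy space of holomorphic functions on $\mathbb{D}^2$ with square-summable Taylor coefficients, let $M_{z_j}$ denote multiplication by $z_j$ on $H^2(\mathbb{D}^2)$, and let $\mathcal{K}_\Theta = H^2(\mathbb{D}^2) \ominus \Theta H^2(\mathbb{D}^2)$. Suppose that \[ \mathcal{K}_\Theta = \mathcal{S}_1 \oplus \mathcal{S}_2 = \widetilde{\mathcal{S}}_1 \oplus \widetilde{\mathcal{S}}_2 \] are two orthogonal decompositions into closed subspaces such that $M_{z_j}\mathcal{S}_j \subseteq \mathcal{S}_j$ and $M_{z_j}\widetilde{\mathcal{S}}_j \subseteq \widetilde{\mathcal{S}}_j$ for $j = 1,2$. For a bounded operator $T$ on a Hilbert space $\mathcal{H}$ write $\mathcal{W}(T) = \{\langle Th,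 h\rangle : h \in \mathcal{H},\ \|h\| = 1\}$ for its numerical range, and let $P_{\mathcal{S}}$ denote the orthogonal projection onto a closed subspace $\mathcal{S}$. Then \[ \mathrm{Clos}\big(\mathcal{W}(P_{\mathcal{S}_2} M_{z_1}|_{\mathcal{S}_2})\big) = \mathrm{Clos}\big(\mathcal{W}(P_{\widetilde{\mathcal{S}}_2} M_{z_1}|_{\widetilde{\mathcal{S}}_2})\big). \] -/

import Mathlib

open scoped ENNReal

noncomputable section

namespace BidiskShift

/-! ### Numerical ranges and compressions on a complex Hilbert space -/

section Operators

variable {E : Type*} [NormedAddCommGroup E] [InnerProductSpace ℂ E]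

/-- The numerical range `{⟨T h, h⟩ : ‖h‖ = 1}`.  (The inner product of Mathlib is linear in its
second argument, so `⟨T h, h⟩` is written `inner ℂ h (T h)`.) -/
def numericalRange (T : E →L[ℂ] E) : Set ℂ :=
  {c : ℂ | ∃ h : E, ‖h‖ = 1 ∧ inner ℂ h (T h) = c}

/-- The compression `P_S T |_S : S → S` of an operator `T` to a closed subspace `S`. -/
def compression [CompleteSpace E] (T : E →L[ℂ] E) (S : ClosedSubmodule ℂ E) :
    S.toSubmodule →L[ℂ] S.toSubmodule :=
  S.toSubmodule.orthogonalProjectionOnto ∘L T ∘L S.toSubmodule.subtypeL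

end Operators

/-! ### The Hardy space of the bidisk -/

/-- The open unit bidisk. -/
def bidisk : Set (ℂ × ℂ) := {z | ‖z.1‖ < 1 ∧ ‖z.2‖ < 1}

/-- The Hardy space `H²(𝔻²)`: the functions `∑ a (j, k) z₁ ^ j z₂ ^ k` on the bidisk with
square-summable Taylor coefficients, with `⟨f, g⟩ = ∑ a (j, k) * conj (b (j, k))`.  An element is
stored as its family of Taylor coefficients; `H2.toFun` gives its values. -/
abbrev H2 : Type := lp (fun _ : ℕ × ℕ => ℂ) 2

namespace H2

/-- The value at `z` of the function on the bidisk with Taylor coefficients `f`. -/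
def toFun (f : H2) (z : ℂ × ℂ) : ℂ := ∑' n : ℕ × ℕ, f n * (z.1 ^ n.1 * z.2 ^ n.2)

/-- The Taylor series of an element of `H²(𝔻²)` converges absolutely on the bidisk. -/
theorem summable_taylor (f : H2) {z : ℂ × ℂ} (hz : z ∈ bidisk) :
    Summable fun n : ℕ × ℕ => f n * (z.1 ^ n.1 * z.2 ^ n.2) := by
  have h1 : Summable fun j : ℕ => ‖z.1 ^ j‖ := by
    simpa using summable_geometric_of_lt_one (norm_nonneg z.1) hz.1
  have h2 : Summable fun k : ℕ => ‖z.2 ^ k‖ := by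
    simpa using summable_geometric_of_lt_one (norm_nonneg z.2) hz.2
  have h3 : Summable fun n : ℕ × ℕ => ‖z.1 ^ n.1 * z.2 ^ n.2‖ :=
    (h1.mul_of_nonneg h2 (fun _ => norm_nonneg _) (fun _ => norm_nonneg _)).congr
      (fun n => by simp)
  refine Summable.of_norm_bounded (h3.mul_left ‖f‖) fun n => ?_
  rw [norm_mul]
  exact mul_le_mul_of_nonneg_right (lp.norm_apply_le_norm (by norm_num) f n) (norm_nonneg _)

theorem hasSum_toFun (f : H2) {z : ℂ × ℂ} (hz : z ∈ bidisk) :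
    HasSum (fun n : ℕ × ℕ => f n * (z.1 ^ n.1 * z.2 ^ n.2)) (f.toFun z) :=
  (f.summable_taylor hz).hasSum

theorem toFun_zero (z : ℂ × ℂ) : toFun 0 z = 0 := by
  simp [toFun]

theorem toFun_add (f g : H2) {z : ℂ × ℂ} (hz : z ∈ bidisk) :
    (f + g).toFun z = f.toFun z + g.toFun z := by
  refine HasSum.unique ((f + g).hasSum_toFun hz) ?_
  simpa [add_mul] using (f.hasSum_toFun hz).add (g.hasSum_toFun hz)

theorem toFun_smul (c : ℂ) (f : H2) (z : ℂ × ℂ) : (c • f).toFun z = c * f.toFun z := by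
  simp [toFun, mul_assoc, tsum_mul_left]

/-- For an injective map `σ` of exponents, the isometry of `H²(𝔻²)` that sends the monomial with
exponent `n` to the monomial with exponent `σ n`. -/
def mapExponents (σ : ℕ × ℕ → ℕ × ℕ) (hσ : Function.Injective σ) : H2 →ₗᵢ[ℂ] H2 where
  toFun f := ⟨Function.extend σ f 0, by
    have h := (lp.memℓp f).summable (by norm_num)
    refine memℓp_gen ?_
    have h' := (hσ.summable_iff
      (f := fun n => ‖Function.extend σ (f : ℕ × ℕ → ℂ) 0 n‖ ^ (2 : ℝ≥0∞).toReal) ?_).1 ?_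
    · exact h'
    · intro n hn
      rw [Function.extend_apply' _ _ _ (by simpa using hn)]
      simp
    · simpa [Function.comp_def, hσ.extend_apply] using h⟩
  map_add' f g := by
    ext n
    by_cases hn : ∃ m, σ m = n
    · obtain ⟨m, rfl⟩ := hn
      change Function.extend σ (⇑(f + g)) 0 (σ m) =
        Function.extend σ (⇑f) 0 (σ m) + Function.extend σ (⇑g) 0 (σ m)
      rw [hσ.extend_apply, hσ.extend_apply, hσ.extend_apply]
      rfl
    · change Function.extend σ (⇑(f + g)) 0 n =
        Function.extend σ (⇑f) 0 n + Function.extend σ (⇑g) 0 n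
      rw [Function.extend_apply' _ _ _ hn, Function.extend_apply' _ _ _ hn,
        Function.extend_apply' _ _ _ hn]
      simp
  map_smul' c f := by
    ext n
    by_cases hn : ∃ m, σ m = n
    · obtain ⟨m, rfl⟩ := hn
      simp [hσ.extend_apply]
    · simp [Function.extend_apply' _ _ _ hn]
  norm_map' f := by
    have h2 : 0 < (2 : ℝ≥0∞).toReal := by norm_num
    simp only [lp.norm_eq_tsum_rpow h2]
    congr 1
    refine (hσ.tsum_eq ?_).symm.trans ?_
    · intro n hn
      by_contra h
      apply hn
      have h' : ¬ ∃ m, σ m = n := by simpa using h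
      simp [Function.extend_apply' _ _ _ h']
    · simp [hσ.extend_apply]

theorem mapExponents_apply (σ : ℕ × ℕ → ℕ × ℕ) (hσ : Function.Injective σ) (f : H2) (n : ℕ × ℕ) :
    mapExponents σ hσ f (σ n) = f n :=
  hσ.extend_apply f 0 n

theorem mapExponents_apply' (σ : ℕ × ℕ → ℕ × ℕ) (hσ : Function.Injective σ) (f : H2) (n : ℕ × ℕ)
    (hn : ¬ ∃ m, σ m = n) : mapExponents σ hσ f n = 0 :=
  Function.extend_apply' _ _ _ hn

theorem succ_injective1 : Function.Injective fun n : ℕ × ℕ => (n.1 + 1, n.2) := fun a b h => by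
  simp only [Prod.mk.injEq, add_left_inj] at h
  exact Prod.ext h.1 h.2

theorem succ_injective2 : Function.Injective fun n : ℕ × ℕ => (n.1, n.2 + 1) := fun a b h => by
  simp only [Prod.mk.injEq, add_left_inj] at h
  exact Prod.ext h.1 h.2

/-- Multiplication by the first variable, `M_{z₁}`, as an operator on `H²(𝔻²)`. -/
def mulZ1 : H2 →L[ℂ] H2 :=
  (mapExponents (fun n => (n.1 + 1, n.2)) succ_injective1).toContinuousLinearMap

/-- Multiplication by the second variable, `M_{z₂}`, as an operator on `H²(𝔻²)`. -/
def mulZ2 : H2 →L[ℂ] H2 :=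
  (mapExponents (fun n => (n.1, n.2 + 1)) succ_injective2).toContinuousLinearMap

theorem toFun_mapExponents (σ : ℕ × ℕ → ℕ × ℕ) (hσ : Function.Injective σ) (f : H2) (z : ℂ × ℂ) :
    (mapExponents σ hσ f).toFun z = ∑' n : ℕ × ℕ, f n * (z.1 ^ (σ n).1 * z.2 ^ (σ n).2) := by
  unfold toFun
  rw [← hσ.tsum_eq]
  · simp only [mapExponents_apply]
  · intro n hn
    by_contra h
    apply hn
    have h' : ¬ ∃ m, σ m = n := by simpa using h
    simp [mapExponents_apply' _ _ _ _ h']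

/-- `M_{z₁}` is multiplication by `z₁`. -/
theorem toFun_mulZ1 (f : H2) (z : ℂ × ℂ) : (mulZ1 f).toFun z = z.1 * f.toFun z := by
  refine (toFun_mapExponents _ succ_injective1 f z).trans ?_
  rw [toFun, ← tsum_mul_left]
  exact tsum_congr fun n => by ring

/-- `M_{z₂}` is multiplication by `z₂`. -/
theorem toFun_mulZ2 (f : H2) (z : ℂ × ℂ) : (mulZ2 f).toFun z = z.2 * f.toFun z := by
  refine (toFun_mapExponents _ succ_injective2 f z).trans ?_
  rw [toFun, ← tsum_mul_left]
  exact tsum_congr fun n => by ring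

end H2

/-! ### Rational inner functions and their model spaces -/

/-- `Θ` is an inner function on the bidisk: it is holomorphic there, and at almost every point
`(e ^ {i s}, e ^ {i t})` of the torus its radial limit exists and is unimodular. -/
structure IsInner (Θ : ℂ × ℂ → ℂ) : Prop where
  holomorphic : DifferentiableOn ℂ Θ bidisk
  boundary : ∀ᵐ x : ℝ × ℝ, ∃ c : ℂ, ‖c‖ = 1 ∧
    Filter.Tendsto
      (fun r : ℝ => Θ ((r : ℂ) * Complex.exp (x.1 * Complex.I),
        (r : ℂ) * Complex.exp (x.2 * Complex.I)))
      (nhdsWithin 1 (Set.Iio 1)) (nhds c)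

/-- `Θ` is a rational inner function on the bidisk: it is inner, and on the bidisk it is a quotient
of two polynomials in two variables whose denominator has no zero there.  (For such a quotient,
unimodular boundary values force `|Θ| ≤ 1` on the bidisk.) -/
structure IsRationalInner (Θ : ℂ × ℂ → ℂ) : Prop extends IsInner Θ where
  rational : ∃ q p : MvPolynomial (Fin 2) ℂ,
    ∀ z ∈ bidisk, MvPolynomial.eval ![z.1, z.2] p ≠ 0 ∧
      Θ z = MvPolynomial.eval ![z.1, z.2] q / MvPolynomial.eval ![z.1, z.2] p

/-- The subspace `Θ H²(𝔻²)` of `H²(𝔻²)`: the functions of `H²(𝔻²)` that have the form `Θ g` on the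
bidisk with `g` in `H²(𝔻²)`. -/
def multiples (Θ : ℂ × ℂ → ℂ) : Submodule ℂ H2 where
  carrier := {f | ∃ g : H2, ∀ z ∈ bidisk, f.toFun z = Θ z * g.toFun z}
  zero_mem' := ⟨0, fun z _ => by simp [H2.toFun_zero]⟩
  add_mem' := by
    rintro f₁ f₂ ⟨g₁, h₁⟩ ⟨g₂, h₂⟩
    refine ⟨g₁ + g₂, fun z hz => ?_⟩
    rw [H2.toFun_add _ _ hz, H2.toFun_add _ _ hz, h₁ z hz, h₂ z hz, mul_add]
  smul_mem' := by
    rintro c f ⟨g, h⟩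
    refine ⟨c • g, fun z hz => ?_⟩
    rw [H2.toFun_smul, H2.toFun_smul, h z hz]
    ring

/-- The model space `K_Θ = H²(𝔻²) ⊖ Θ H²(𝔻²)`. -/
def modelSpace (Θ : ℂ × ℂ → ℂ) : Submodule ℂ H2 := (multiples Θ)ᗮ

/-- `K_Θ = S₁ ⊕ S₂` is an orthogonal decomposition into closed subspaces such that `S₁` is
`z₁`-invariant and `S₂` is `z₂`-invariant. -/
structure IsShiftDecomposition (Θ : ℂ × ℂ → ℂ) (S₁ S₂ : ClosedSubmodule ℂ H2) : Prop where
  orthogonal : S₁.toSubmodule ⟂ S₂.toSubmodule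
  sum_eq : S₁.toSubmodule ⊔ S₂.toSubmodule = modelSpace Θ
  invariant₁ : ∀ f ∈ S₁, H2.mulZ1 f ∈ S₁
  invariant₂ : ∀ f ∈ S₂, H2.mulZ2 f ∈ S₂

end BidiskShift

end

/-! Embed `H²(𝔻²)` in `ℓ²(ℕ × ℤ)`, where `z₂` becomes unitary and commutes with the isometry `z₁`. A
vector `z₂ ^ (-k) * v` then has the same Rayleigh quotient for `z₁` as `v`. It therefore suffices
that the closure of `⋃ z₂ ^ (-k) T₂` does not depend on the decomposition: it is the orthogonal
complement of `⋃ z₂ ^ (-k) Θ H²`.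

The two unions are orthogonal, so the point is that a vector `f` orthogonal to both vanishes
(`IsShiftDecomposition.eq_zero_of_orthogonal`). The projection of `z₂ ^ k * f` to `H²` lies in `T₁`,
hence so do its products with `z₁ ^ d`, and these are orthogonal to all monomial multiples of the
numerator `q` of `Θ = q / p`. Pairing the lowest row of `f` in the `z₁`-degree with the top row of
`q` gives a linear recurrence for a sequence vanishing at both ends of `ℤ`, and such a sequence is
zero (`eq_zero_of_linear_recurrence`). -/

/-! ### Linear recurrences on `ℤ` -/

open Polynomial in
/-- A nonzero polynomial in the bilateral shift is injective on sequences that vanish at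
infinity. -/
theorem eq_zero_of_aeval_shift_eq_zero (P : ℂ[X]) (hP : P ≠ 0) (y : ℤ → ℂ)
    (hy : Filter.Tendsto y Filter.cofinite (nhds 0))
    (h : aeval (LinearMap.funLeft ℂ ℂ (fun n : ℤ => n + 1)) P y = 0) : y = 0 := by
  induction hn : P.natDegree generalizing P y with
  | zero =>
    obtain ⟨c, rfl⟩ := natDegree_eq_zero.1 hn
    have hc : c ≠ 0 := by simpa using hP
    rw [aeval_C, Module.algebraMap_end_apply] at h
    exact (smul_eq_zero.1 h).resolve_left hc
  | succ d ih =>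
    obtain ⟨r, hr⟩ := IsAlgClosed.exists_root P
      (by rw [degree_eq_natDegree hP, hn]; exact_mod_cast Nat.succ_ne_zero d)
    obtain ⟨Q, rfl⟩ := dvd_iff_isRoot.2 hr
    have hQ : Q ≠ 0 := right_ne_zero_of_mul hP
    have hd : Q.natDegree = d := by
      rw [natDegree_mul (X_sub_C_ne_zero r) hQ, natDegree_X_sub_C] at hn
      omega
    have hshift (e : ℤ) : Filter.Tendsto (fun n => y (n + e)) Filter.cofinite (nhds 0) :=
      hy.comp (add_left_injective e).tendsto_cofinite
    -- With `P = (X - r) Q`, the sequence `(shift - r) y` still vanishes at infinity and is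
    -- annihilated by `Q`.
    have hrec : (fun n => y (n + 1) - r * y n) = 0 := by
      refine ih Q hQ _ (by simpa using (hshift 1).sub (hy.const_mul r)) ?_ hd
      rw [mul_comm, map_mul, Module.End.mul_apply] at h
      convert h using 2
      ext n
      simp [LinearMap.funLeft_apply]
    have hstep (n : ℤ) : y (n + 1) = r * y n := sub_eq_zero.1 (congrFun hrec n)
    have hpow (k : ℕ) : ∀ n : ℤ, y (n + k) = r ^ k * y n := by
      induction k with
      | zero => simp
      | succ k ihk => intro n; push_cast; rw [← add_assoc, hstep, ihk]; ring
    ext n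
    rw [Pi.zero_apply, ← norm_eq_zero]
    refine le_antisymm ?_ (norm_nonneg _)
    -- A geometric sequence does not decay in both directions: `‖y n‖` is bounded by the later terms
    -- if `1 ≤ ‖r‖`, by the earlier ones if `‖r‖ ≤ 1`.
    rcases le_total 1 ‖r‖ with h1 | h1
    · have ht : Filter.Tendsto (fun k : ℕ => ‖y (n + k)‖) Filter.atTop (nhds 0) := by
        rw [← Nat.cofinite_eq_atTop]
        refine tendsto_zero_iff_norm_tendsto_zero.1 (hy.comp (Function.Injective.tendsto_cofinite ?_))
        intro a b hab
        simpa using hab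
      refine ge_of_tendsto' ht fun k => ?_
      rw [hpow, norm_mul, norm_pow]
      exact le_mul_of_one_le_left (norm_nonneg _) (one_le_pow₀ h1)
    · have ht : Filter.Tendsto (fun k : ℕ => ‖y (n - k)‖) Filter.atTop (nhds 0) := by
        rw [← Nat.cofinite_eq_atTop]
        refine tendsto_zero_iff_norm_tendsto_zero.1 (hy.comp (Function.Injective.tendsto_cofinite ?_))
        intro a b hab
        simpa using hab
      refine ge_of_tendsto' ht fun k => ?_
      have := hpow k (n - k)
      rw [sub_add_cancel] at this
      rw [this, norm_mul, norm_pow]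
      exact mul_le_of_le_one_left (norm_nonneg _) (pow_le_one₀ (norm_nonneg _) h1)

open Polynomial in
/-- A bi-infinite sequence that vanishes at infinity and satisfies a nontrivial linear recurrence
with constant coefficients is zero. -/
theorem eq_zero_of_linear_recurrence (s : Finset ℕ) (c : ℕ → ℂ) {b₀ : ℕ} (hb₀ : b₀ ∈ s)
    (hc : c b₀ ≠ 0) (y : ℤ → ℂ) (hy : Filter.Tendsto y Filter.cofinite (nhds 0))
    (h : ∀ n : ℤ, ∑ b ∈ s, c b * y (n + b) = 0) : y = 0 := by
  refine eq_zero_of_aeval_shift_eq_zero (∑ b ∈ s, C (c b) * X ^ b) ?_ y hy ?_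
  · intro h0
    have := congrArg (fun P : ℂ[X] => P.coeff b₀) h0
    simp [hb₀, hc] at this
  · have hpow (b : ℕ) : ∀ n : ℤ,
        ((LinearMap.funLeft ℂ ℂ (fun n : ℤ => n + 1)) ^ b) y n = y (n + b) := by
      induction b with
      | zero => simp
      | succ b ih =>
        intro n
        rw [pow_succ', Module.End.mul_apply, LinearMap.funLeft_apply, ih]
        push_cast
        ring_nf
    ext n
    simpa [hpow, map_sum, LinearMap.sum_apply, Module.algebraMap_end_apply] using h n

/-! ### Isometries of `ℓ²` induced by injections of the index set -/

namespace BidiskShift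

/-- For an injective map `σ` of indices, the isometry of `ℓ²` spaces that sends the basis vector
with index `i` to the one with index `σ i`. -/
noncomputable def lpEmbed {α β : Type*} (σ : α → β) (hσ : Function.Injective σ) :
    lp (fun _ : α => ℂ) 2 →ₗᵢ[ℂ] lp (fun _ : β => ℂ) 2 where
  toFun f := ⟨Function.extend σ f 0, by
    have h := (lp.memℓp f).summable (by norm_num)
    refine memℓp_gen ?_
    refine (hσ.summable_iff
      (f := fun n => ‖Function.extend σ (f : α → ℂ) 0 n‖ ^ (2 : ℝ≥0∞).toReal) ?_).1 ?_
    · intro n hn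
      rw [Function.extend_apply' _ _ _ (by simpa using hn)]
      simp
    · simpa [Function.comp_def, hσ.extend_apply] using h⟩
  map_add' f g := by
    ext n
    by_cases hn : ∃ m, σ m = n
    · obtain ⟨m, rfl⟩ := hn
      change Function.extend σ (⇑(f + g)) 0 (σ m) =
        Function.extend σ (⇑f) 0 (σ m) + Function.extend σ (⇑g) 0 (σ m)
      rw [hσ.extend_apply, hσ.extend_apply, hσ.extend_apply]
      rfl
    · change Function.extend σ (⇑(f + g)) 0 n =
        Function.extend σ (⇑f) 0 n + Function.extend σ (⇑g) 0 n
      rw [Function.extend_apply' _ _ _ hn, Function.extend_apply' _ _ _ hn,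
        Function.extend_apply' _ _ _ hn]
      simp
  map_smul' c f := by
    ext n
    by_cases hn : ∃ m, σ m = n
    · obtain ⟨m, rfl⟩ := hn
      simp [hσ.extend_apply]
    · simp [Function.extend_apply' _ _ _ hn]
  norm_map' f := by
    have h2 : 0 < (2 : ℝ≥0∞).toReal := by norm_num
    simp only [lp.norm_eq_tsum_rpow h2]
    congr 1
    refine (hσ.tsum_eq ?_).symm.trans ?_
    · intro n hn
      by_contra h
      apply hn
      have h' : ¬ ∃ m, σ m = n := by simpa using h
      simp [Function.extend_apply' _ _ _ h']
    · simp [hσ.extend_apply]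

section lpEmbed

variable {α β γ : Type*} (σ : α → β) (hσ : Function.Injective σ)

theorem lpEmbed_apply (f : lp (fun _ : α => ℂ) 2) (n : α) : lpEmbed σ hσ f (σ n) = f n :=
  hσ.extend_apply f 0 n

theorem lpEmbed_apply' (f : lp (fun _ : α => ℂ) 2) (n : β) (hn : ¬ ∃ m, σ m = n) :
    lpEmbed σ hσ f n = 0 :=
  Function.extend_apply' _ _ _ hn

theorem lpEmbed_lpEmbed (τ : β → γ) (hτ : Function.Injective τ) (f : lp (fun _ : α => ℂ) 2) :
    lpEmbed τ hτ (lpEmbed σ hσ f) = lpEmbed (τ ∘ σ) (hτ.comp hσ) f := by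
  ext n
  by_cases h : ∃ m, τ m = n
  · obtain ⟨m, rfl⟩ := h
    rw [lpEmbed_apply]
    by_cases h' : ∃ l, σ l = m
    · obtain ⟨l, rfl⟩ := h'
      rw [lpEmbed_apply]
      exact (lpEmbed_apply (τ ∘ σ) (hτ.comp hσ) f l).symm
    · rw [lpEmbed_apply' _ _ _ _ h', lpEmbed_apply']
      rintro ⟨l, hl⟩
      exact h' ⟨l, hτ hl⟩
  · rw [lpEmbed_apply' _ _ _ _ h, lpEmbed_apply']
    rintro ⟨l, hl⟩
    exact h ⟨_, hl⟩

open ContinuousLinearMap in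
theorem adjoint_lpEmbed_apply (f : lp (fun _ : β => ℂ) 2) (n : α) :
    adjoint (lpEmbed σ hσ).toContinuousLinearMap f n = f (σ n) := by
  classical
  have h1 : lpEmbed σ hσ (lp.single 2 n 1) = lp.single 2 (σ n) 1 := by
    ext m
    by_cases h : ∃ l, σ l = m
    · obtain ⟨l, rfl⟩ := h
      rw [lpEmbed_apply]
      by_cases hl : l = n
      · subst hl; simp
      · have : σ l ≠ σ n := fun h => hl (hσ h)
        simp [hl, this]
    · have : m ≠ σ n := fun h' => h ⟨n, h'.symm⟩
      rw [lpEmbed_apply' _ _ _ _ h]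
      simp [this]
  have h2 := adjoint_inner_right (lpEmbed σ hσ).toContinuousLinearMap (lp.single 2 n 1) f
  rw [LinearIsometry.coe_toContinuousLinearMap, h1, lp.inner_single_left,
    lp.inner_single_left] at h2
  simpa using h2

end lpEmbed

/-! ### Multiplication by monomials -/

theorem mulZ1_eq_lpEmbed (f : H2) :
    H2.mulZ1 f = lpEmbed (fun n : ℕ × ℕ => (n.1 + 1, n.2)) H2.succ_injective1 f := rfl

theorem mulZ2_eq_lpEmbed (f : H2) :
    H2.mulZ2 f = lpEmbed (fun n : ℕ × ℕ => (n.1, n.2 + 1)) H2.succ_injective2 f := rfl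

theorem add_injective (a b : ℕ) : Function.Injective fun n : ℕ × ℕ => (n.1 + a, n.2 + b) :=
  fun m n h => by
    simp only [Prod.mk.injEq, add_left_inj] at h
    exact Prod.ext h.1 h.2

/-- Multiplication by the monomial `z₁ ^ a * z₂ ^ b`. -/
noncomputable def mulMonomial (a b : ℕ) : H2 →ₗᵢ[ℂ] H2 := lpEmbed _ (add_injective a b)

theorem toFun_mulMonomial (a b : ℕ) (f : H2) (z : ℂ × ℂ) :
    (mulMonomial a b f).toFun z = z.1 ^ a * z.2 ^ b * f.toFun z := by
  refine (H2.toFun_mapExponents _ (add_injective a b) f z).trans ?_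
  rw [H2.toFun, ← tsum_mul_left]
  exact tsum_congr fun n => by ring

theorem mulMonomial_mem_multiples {Θ : ℂ × ℂ → ℂ} {f : H2} (hf : f ∈ multiples Θ) (a b : ℕ) :
    mulMonomial a b f ∈ multiples Θ := by
  obtain ⟨g, hg⟩ := hf
  refine ⟨mulMonomial a b g, fun z hz => ?_⟩
  rw [toFun_mulMonomial, toFun_mulMonomial, hg z hz]
  ring

theorem mulMonomial_mem {S : ClosedSubmodule ℂ H2} (hS : ∀ f ∈ S, H2.mulZ1 f ∈ S) {f : H2}
    (hf : f ∈ S) (d : ℕ) : mulMonomial d 0 f ∈ S := by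
  induction d with
  | zero =>
    convert hf
    ext n
    exact lpEmbed_apply _ (add_injective 0 0) f n
  | succ d ih =>
    convert hS _ ih
    rw [mulZ1_eq_lpEmbed, mulMonomial, mulMonomial, lpEmbed_lpEmbed]
    rfl

/-! ### The enlarged space `ℓ²(ℕ × ℤ)`, on which multiplication by `z₂` is invertible -/

theorem sub_injective (k : ℕ) :
    Function.Injective fun n : ℕ × ℕ => ((n.1, (n.2 : ℤ) - k) : ℕ × ℤ) := fun m n h => by
  simp only [Prod.mk.injEq, sub_left_inj, Nat.cast_inj] at h
  exact Prod.ext h.1 h.2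

/-- The embedding `f ↦ z₂ ^ (-k) * f` of `H²(𝔻²)` into `ℓ²(ℕ × ℤ)`. -/
noncomputable def shiftEmbed (k : ℕ) : H2 →ₗᵢ[ℂ] lp (fun _ : ℕ × ℤ => ℂ) 2 := lpEmbed _ (sub_injective k)

theorem succ_injective_int : Function.Injective fun n : ℕ × ℤ => (n.1 + 1, n.2) := fun a b h => by
  simp only [Prod.mk.injEq, add_left_inj] at h
  exact Prod.ext h.1 h.2

/-- Multiplication by `z₁` on `ℓ²(ℕ × ℤ)`. -/
noncomputable def extendedMulZ1 : lp (fun _ : ℕ × ℤ => ℂ) 2 →ₗᵢ[ℂ] lp (fun _ : ℕ × ℤ => ℂ) 2 :=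
  lpEmbed _ succ_injective_int

theorem extendedMulZ1_shiftEmbed (k : ℕ) (f : H2) :
    extendedMulZ1 (shiftEmbed k f) = shiftEmbed k (H2.mulZ1 f) := by
  rw [mulZ1_eq_lpEmbed, extendedMulZ1, shiftEmbed, lpEmbed_lpEmbed, lpEmbed_lpEmbed]
  rfl

/-- This makes the spaces `z₂ ^ (-k) S` increase with `k` when `S` is `z₂`-invariant. -/
theorem shiftEmbed_succ (k : ℕ) (f : H2) : shiftEmbed (k + 1) (H2.mulZ2 f) = shiftEmbed k f := by
  rw [mulZ2_eq_lpEmbed, shiftEmbed, shiftEmbed, lpEmbed_lpEmbed]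
  congr! 2
  ext n <;> simp

theorem shiftEmbed_mulZ2_pow (k i : ℕ) (f : H2) :
    shiftEmbed (k + i) (H2.mulZ2^[i] f) = shiftEmbed k f := by
  induction i with
  | zero => rfl
  | succ i ih => rw [Function.iterate_succ_apply', ← add_assoc, shiftEmbed_succ, ih]

open ContinuousLinearMap in
theorem adjoint_shiftEmbed_apply (k : ℕ) (f : lp (fun _ : ℕ × ℤ => ℂ) 2) (n : ℕ × ℕ) :
    adjoint (shiftEmbed k).toContinuousLinearMap f n = f (n.1, (n.2 : ℤ) - k) :=
  adjoint_lpEmbed_apply _ (sub_injective k) f n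

open ContinuousLinearMap in
/-- An element of `ℓ²(ℕ × ℤ)` whose products with all `z₁ ^ j * z₂ ^ n` have a projection to
`H²(𝔻²)` orthogonal to a nonzero polynomial's monomial multiples is zero. -/
theorem eq_zero_of_inner_mulMonomial_eq_zero (q : H2) (hq : q ≠ 0)
    (hfin : {n : ℕ × ℕ | q n ≠ 0}.Finite) (f : lp (fun _ : ℕ × ℤ => ℂ) 2)
    (h : ∀ a i d k : ℕ, inner ℂ (mulMonomial a i q)
      (mulMonomial d 0 (adjoint (shiftEmbed k).toContinuousLinearMap f)) = 0) : f = 0 := by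
  classical
  by_contra hf
  have hex : ∃ a : ℕ, ∃ b : ℤ, f (a, b) ≠ 0 := by
    by_contra! H
    exact hf (by ext ⟨a, b⟩; exact H a b)
  -- `a` is the lowest `z₁`-degree in `f`; below, `d` is the highest `z₁`-degree in `q`.
  set a := Nat.find hex with ha
  obtain ⟨b₁, hb₁⟩ := Nat.find_spec hex
  have hlow (m : ℕ) (hm : m < a) (b : ℤ) : f (m, b) = 0 := by
    by_contra H
    exact Nat.find_min hex hm ⟨b, H⟩
  have hne : hfin.toFinset.Nonempty := by
    by_contra H
    rw [Finset.not_nonempty_iff_eq_empty] at H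
    refine hq ?_
    ext n
    by_contra hn
    have : n ∈ hfin.toFinset := by simpa using hn
    simp [H] at this
  obtain ⟨t, ht, htmax⟩ := Finset.exists_max_image hfin.toFinset Prod.fst hne
  set d := t.1 with hd
  refine hb₁ (congrFun (eq_zero_of_linear_recurrence (hfin.toFinset.image Prod.snd)
    (fun b => starRingEnd ℂ (q (d, b))) (Finset.mem_image_of_mem _ ht) (by simpa [hd] using ht)
    (fun b => f (a, b)) ?_ ?_) b₁)
  · have h0 : Filter.Tendsto (fun n => f n) Filter.cofinite (nhds 0) := by
      have := ((lp.memℓp f).summable (by norm_num)).tendsto_cofinite_zero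
      rw [tendsto_zero_iff_norm_tendsto_zero]
      have h2 := this.sqrt
      simpa using h2
    exact h0.comp (Prod.mk_right_injective a).tendsto_cofinite
  · intro n
    -- Since `n.toNat - (-n).toNat = n`, these two natural exponents of `z₂` realise the integer
    -- shift `n`.
    have key := h a n.toNat d (-n).toNat
    rw [← LinearIsometry.coe_toContinuousLinearMap (mulMonomial a n.toNat), ← adjoint_inner_right,
      lp.inner_eq_tsum] at key
    set g := adjoint (shiftEmbed (-n).toNat).toContinuousLinearMap f with hg
    -- The coefficient `q m` meets row `m.1 + a - d` of `f`. As `m.1 ≤ d`, that row lies below `a`,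
    -- where `f` vanishes, unless `m.1 = d`.
    have hterm (m : ℕ × ℕ) : inner ℂ (q m) (adjoint (mulMonomial a n.toNat).toContinuousLinearMap
        (mulMonomial d 0 g) m) =
        if m.1 = d then starRingEnd ℂ (q (d, m.2)) * f (a, n + m.2) else 0 := by
      by_cases hm : q m = 0
      · rw [hm, inner_zero_left]
        split_ifs with h'
        · rw [← h', Prod.mk.eta, hm]; simp
        · rfl
      have hmd : m.1 ≤ d := htmax m (by simpa using hm)
      have e1 : adjoint (mulMonomial a n.toNat).toContinuousLinearMap (mulMonomial d 0 g) m =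
          mulMonomial d 0 g (m.1 + a, m.2 + n.toNat) :=
        adjoint_lpEmbed_apply _ (add_injective a n.toNat) _ m
      rw [e1]
      have e2 (l : ℕ) (hl : l + d = m.1 + a) : mulMonomial d 0 g (m.1 + a, m.2 + n.toNat) =
          f (l, n + m.2) := by
        rw [← hl]
        refine (lpEmbed_apply _ (add_injective d 0) g (l, m.2 + n.toNat)).trans ?_
        rw [hg, adjoint_shiftEmbed_apply]
        have : ((m.2 + n.toNat : ℕ) : ℤ) - (-n).toNat = n + m.2 := by omega
        rw [this]
      split_ifs with h'
      · rw [e2 a (by omega), RCLike.inner_apply, mul_comm, ← h']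
      · by_cases hle : d ≤ m.1 + a
        · rw [e2 (m.1 + a - d) (by omega), hlow _ (by omega), inner_zero_right]
        · have : mulMonomial d 0 g (m.1 + a, m.2 + n.toNat) = 0 := by
            refine lpEmbed_apply' _ (add_injective d 0) g _ ?_
            rintro ⟨l, hl⟩
            simp only [Prod.mk.injEq] at hl
            omega
          rw [this, inner_zero_right]
    rw [tsum_congr hterm] at key
    rw [← key, ← (Prod.mk_right_injective d).tsum_eq]
    · rw [tsum_eq_sum (s := hfin.toFinset.image Prod.snd)]
      · simp
      · intro b hb
        have : q (d, b) = 0 := by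
          by_contra H
          exact hb (Finset.mem_image.2 ⟨(d, b), by simpa using H, rfl⟩)
        simp [this]
    · intro m hm
      have : m.1 = d := by
        by_contra H
        simp [H] at hm
      exact ⟨m.2, by rw [← this]⟩

/-! ### Polynomials in the Hardy space -/

theorem exists_toFun_eq_eval (P : MvPolynomial (Fin 2) ℂ) :
    ∃ f : H2, {n : ℕ × ℕ | f n ≠ 0}.Finite ∧
      ∀ z ∈ bidisk, f.toFun z = MvPolynomial.eval ![z.1, z.2] P := by
  classical
  have hembed (σ : ℕ × ℕ → ℕ × ℕ) (hσ : Function.Injective σ) (f : H2)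
      (hf : {n : ℕ × ℕ | f n ≠ 0}.Finite) : {n : ℕ × ℕ | lpEmbed σ hσ f n ≠ 0}.Finite := by
    refine (hf.image σ).subset fun n hn => ?_
    by_cases h : ∃ m, σ m = n
    · obtain ⟨m, rfl⟩ := h
      rw [Set.mem_ofPred_eq, lpEmbed_apply] at hn
      exact ⟨m, hn, rfl⟩
    · exact absurd (lpEmbed_apply' σ hσ f n h) hn
  induction P using MvPolynomial.induction_on with
  | C c =>
    refine ⟨lp.single 2 (0, 0) c, (Set.finite_singleton (0, 0)).subset fun n hn => ?_, ?_⟩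
    · by_contra H
      exact hn (lp.single_apply_ne (E := fun _ : ℕ × ℕ => ℂ) 2 (0, 0) c H)
    · intro z _
      rw [H2.toFun, tsum_eq_single (0, 0)]
      · simp
      · intro n hn
        rw [lp.single_apply_ne 2 _ _ hn, zero_mul]
  | add P Q hP hQ =>
    obtain ⟨f, hf, hfP⟩ := hP
    obtain ⟨g, hg, hgQ⟩ := hQ
    refine ⟨f + g, (hf.union hg).subset fun n hn => ?_, fun z hz => ?_⟩
    · by_contra H
      simp only [Set.mem_union, Set.mem_ofPred_eq, not_or, not_not] at H
      exact hn (by simp [H.1, H.2])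
    · rw [H2.toFun_add _ _ hz, hfP z hz, hgQ z hz, map_add]
  | mul_X P i hP =>
    obtain ⟨f, hf, hfP⟩ := hP
    fin_cases i
    · refine ⟨H2.mulZ1 f, hembed _ H2.succ_injective1 f hf, fun z hz => ?_⟩
      rw [H2.toFun_mulZ1, hfP z hz]
      simp [mul_comm]
    · refine ⟨H2.mulZ2 f, hembed _ H2.succ_injective2 f hf, fun z hz => ?_⟩
      rw [H2.toFun_mulZ2, hfP z hz]
      simp [mul_comm]

/-- Radial limits of the zero function are not unimodular. This ensures that the numerator of `Θ` is
nonzero. -/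
theorem IsInner.exists_ne_zero {Θ : ℂ × ℂ → ℂ} (hΘ : IsInner Θ) : ∃ z ∈ bidisk, Θ z ≠ 0 := by
  by_contra! H
  obtain ⟨x, c, hc, hx⟩ := hΘ.boundary.exists
  have h0 : Filter.Tendsto (fun r : ℝ => Θ ((r : ℂ) * Complex.exp (x.1 * Complex.I),
      (r : ℂ) * Complex.exp (x.2 * Complex.I))) (nhdsWithin 1 (Set.Iio 1)) (nhds 0) := by
    refine tendsto_const_nhds.congr' ?_
    filter_upwards [Ioo_mem_nhdsLT (show (0 : ℝ) < 1 by norm_num)] with r hr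
    refine (H _ ⟨?_, ?_⟩).symm <;>
    · rw [norm_mul, Complex.norm_exp_ofReal_mul_I, mul_one, Complex.norm_real, Real.norm_eq_abs,
        abs_of_pos hr.1]
      exact hr.2
  rw [tendsto_nhds_unique hx h0, norm_zero] at hc
  exact zero_ne_one hc

/-- For a rational inner function `Θ = q / p`, the nonzero polynomial `q` lies in `Θ H²(𝔻²)`. -/
theorem IsRationalInner.exists_polynomial_mem_multiples {Θ : ℂ × ℂ → ℂ} (hΘ : IsRationalInner Θ) :
    ∃ f ∈ multiples Θ, f ≠ 0 ∧ {n : ℕ × ℕ | f n ≠ 0}.Finite := by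
  obtain ⟨q, p, hqp⟩ := hΘ.rational
  obtain ⟨f, hf, hfq⟩ := exists_toFun_eq_eval q
  obtain ⟨g, -, hgp⟩ := exists_toFun_eq_eval p
  -- The identity `q = Θ * p` exhibits `q` as a multiple, with `p` itself as cofactor.
  refine ⟨f, ⟨g, fun z hz => ?_⟩, ?_, hf⟩
  · rw [hfq z hz, hgp z hz, (hqp z hz).2, div_mul_cancel₀ _ (hqp z hz).1]
  · rintro rfl
    obtain ⟨z, hz, hne⟩ := hΘ.exists_ne_zero
    refine hne ?_
    rw [(hqp z hz).2, ← hfq z hz, H2.toFun_zero, zero_div]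

/-! ### Comparison of two decompositions -/

section Decomposition

variable {Θ : ℂ × ℂ → ℂ} {S₁ S₂ T₁ T₂ : ClosedSubmodule ℂ H2}

theorem IsShiftDecomposition.mem_of_orthogonal (hT : IsShiftDecomposition Θ T₁ T₂) {f : H2}
    (hf : f ∈ modelSpace Θ) (h : ∀ v ∈ T₂, inner ℂ v f = 0) : f ∈ T₁ := by
  rw [← hT.sum_eq] at hf
  obtain ⟨a, ha, b, hb, rfl⟩ := Submodule.mem_sup.1 hf
  have hab := h b hb
  rw [inner_add_right, Submodule.isOrtho_iff_inner_eq.1 hT.orthogonal.symm b hb a ha, zero_add,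
    inner_self_eq_zero] at hab
  rw [hab, add_zero]
  exact ha

open ContinuousLinearMap in
/-- An element of `ℓ²(ℕ × ℤ)` orthogonal to all `z₂ ^ (-k) T₂` and all `z₂ ^ (-k) Θ H²` is zero. -/
theorem IsShiftDecomposition.eq_zero_of_orthogonal (hΘ : IsRationalInner Θ)
    (hT : IsShiftDecomposition Θ T₁ T₂) (f : lp (fun _ : ℕ × ℤ => ℂ) 2)
    (h₁ : ∀ k, ∀ v ∈ T₂, inner ℂ (shiftEmbed k v) f = 0)
    (h₂ : ∀ k, ∀ v ∈ multiples Θ, inner ℂ (shiftEmbed k v) f = 0) : f = 0 := by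
  obtain ⟨q, hq, hq0, hfin⟩ := hΘ.exists_polynomial_mem_multiples
  refine eq_zero_of_inner_mulMonomial_eq_zero q hq0 hfin f fun a i d k => ?_
  -- This adjoint is the projection of `z₂ ^ k * f` to `H²(𝔻²)`.
  have hmem : adjoint (shiftEmbed k).toContinuousLinearMap f ∈ T₁ := by
    refine hT.mem_of_orthogonal ((Submodule.mem_orthogonal _ _).2 fun u hu => ?_) fun v hv => ?_
    · rw [adjoint_inner_right]
      exact h₂ k u hu
    · rw [adjoint_inner_right]
      exact h₁ k v hv
  have hK : mulMonomial d 0 (adjoint (shiftEmbed k).toContinuousLinearMap f) ∈ modelSpace Θ := by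
    rw [← hT.sum_eq]
    exact Submodule.mem_sup_left (mulMonomial_mem hT.invariant₁ hmem d)
  exact (Submodule.mem_orthogonal _ _).1 hK _ (mulMonomial_mem_multiples hq a i)

/-- The union of the spaces `z₂ ^ (-k) T₂`. -/
def saturation (hT : IsShiftDecomposition Θ T₁ T₂) :
    Submodule ℂ (lp (fun _ : ℕ × ℤ => ℂ) 2) where
  carrier := {x | ∃ k, ∃ v ∈ T₂, shiftEmbed k v = x}
  zero_mem' := ⟨0, 0, T₂.toSubmodule.zero_mem, map_zero _⟩
  add_mem' := by
    have hit (i : ℕ) {v : H2} (hv : v ∈ T₂) : H2.mulZ2^[i] v ∈ T₂ := by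
      induction i with
      | zero => exact hv
      | succ i ih => rw [Function.iterate_succ_apply']; exact hT.invariant₂ _ ih
    rintro _ _ ⟨k, v, hv, rfl⟩ ⟨l, w, hw, rfl⟩
    -- Both summands are brought to the common denominator `z₂ ^ (k + l)`.
    refine ⟨k + l, H2.mulZ2^[l] v + H2.mulZ2^[k] w,
      T₂.toSubmodule.add_mem (hit l hv) (hit k hw), ?_⟩
    rw [map_add, shiftEmbed_mulZ2_pow, add_comm k l, shiftEmbed_mulZ2_pow]
  smul_mem' := by
    rintro c _ ⟨k, v, hv, rfl⟩
    exact ⟨k, c • v, T₂.toSubmodule.smul_mem c hv, map_smul _ _ _⟩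

/-- Multiplying both vectors by `z₂ ^ (k + l)` moves the pairing into `H²(𝔻²)`, where both `T₂` and
`Θ H²` are `z₂`-invariant and `T₂` lies in the model space. -/
theorem IsShiftDecomposition.inner_shiftEmbed_eq_zero (hT : IsShiftDecomposition Θ T₁ T₂)
    {u v : H2} (hu : u ∈ multiples Θ) (hv : v ∈ T₂) (k l : ℕ) :
    inner ℂ (shiftEmbed k u) (shiftEmbed l v) = 0 := by
  have hmod (m : ℕ) : H2.mulZ2^[m] v ∈ T₂ := by
    induction m with
    | zero => exact hv
    | succ m ih => rw [Function.iterate_succ_apply']; exact hT.invariant₂ _ ih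
  have hmul (m : ℕ) : H2.mulZ2^[m] u ∈ multiples Θ := by
    induction m with
    | zero => exact hu
    | succ m ih =>
      rw [Function.iterate_succ_apply']
      exact mulMonomial_mem_multiples ih 0 1
  rw [← shiftEmbed_mulZ2_pow k l u, ← shiftEmbed_mulZ2_pow l k v, add_comm l k,
    LinearIsometry.inner_map_map]
  have hK : H2.mulZ2^[k] v ∈ modelSpace Θ := by
    rw [← hT.sum_eq]
    exact Submodule.mem_sup_right (hmod k)
  exact (Submodule.mem_orthogonal _ _).1 hK _ (hmul l)

/-- The component `z` of `h` orthogonal to the closure is also orthogonal to every `z₂ ^ (-k) Θ H²`,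
because `h` and its projection to the closure both are; hence it vanishes. -/
theorem IsShiftDecomposition.shiftEmbed_mem_closure (hΘ : IsRationalInner Θ)
    (hS : IsShiftDecomposition Θ S₁ S₂) (hT : IsShiftDecomposition Θ T₁ T₂) {h : H2}
    (hh : h ∈ S₂) : shiftEmbed 0 h ∈ closure {x | ∃ k, ∃ v ∈ T₂, shiftEmbed k v = x} := by
  change shiftEmbed 0 h ∈ (saturation hT).topologicalClosure
  set C := (saturation hT).topologicalClosure with hC
  have : CompleteSpace C := (saturation hT).isClosed_topologicalClosure.completeSpace_coe
  obtain ⟨y, hy, z, hz, hyz⟩ := C.exists_add_mem_mem_orthogonal (shiftEmbed 0 h)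
  suffices z = 0 by rwa [hyz, this, add_zero]
  refine hT.eq_zero_of_orthogonal hΘ z (fun k v hv => ?_) fun k u hu => ?_
  · exact (Submodule.mem_orthogonal _ _).1 hz _
      ((saturation hT).le_topologicalClosure ⟨k, v, hv, rfl⟩)
  · have hzero : inner ℂ (shiftEmbed k u) y = 0 := by
      have hle : C ≤ (ℂ ∙ shiftEmbed k u)ᗮ := by
        refine Submodule.topologicalClosure_minimal _ ?_ (Submodule.isClosed_orthogonal _)
        rintro _ ⟨l, v, hv, rfl⟩
        exact Submodule.mem_orthogonal_singleton_iff_inner_right.2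
          (hT.inner_shiftEmbed_eq_zero hu hv k l)
      exact Submodule.mem_orthogonal_singleton_iff_inner_right.1 (hle hy)
    have := hS.inner_shiftEmbed_eq_zero hu hh k 0
    rwa [hyz, inner_add_right, hzero, zero_add] at this

/-! ### Comparison of numerical ranges -/

theorem mem_numericalRange_compression {T : H2 →L[ℂ] H2} {S : ClosedSubmodule ℂ H2} {c : ℂ} :
    c ∈ numericalRange (compression T S) ↔ ∃ h ∈ S, ‖h‖ = 1 ∧ inner ℂ h (T h) = c := by
  have hinner (h : S.toSubmodule) : inner ℂ h (compression T S h) = inner ℂ (h : H2) (T h) := by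
    simp [compression]
  constructor
  · rintro ⟨h, h1, rfl⟩
    exact ⟨h, h.2, h1, (hinner h).symm⟩
  · rintro ⟨h, hS, h1, rfl⟩
    exact ⟨⟨h, hS⟩, h1, hinner ⟨h, hS⟩⟩

theorem IsShiftDecomposition.numericalRange_subset (hΘ : IsRationalInner Θ)
    (hS : IsShiftDecomposition Θ S₁ S₂) (hT : IsShiftDecomposition Θ T₁ T₂) :
    numericalRange (compression H2.mulZ1 S₂) ⊆
      closure (numericalRange (compression H2.mulZ1 T₂)) := by
  intro c hc
  obtain ⟨h, hh, h1, rfl⟩ := mem_numericalRange_compression.1 hc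
  set x := shiftEmbed 0 h with hx
  have hx1 : ‖x‖ = 1 := by rw [hx, LinearIsometry.norm_map, h1]
  have hx0 : x ≠ 0 := norm_ne_zero_iff.1 (by rw [hx1]; exact one_ne_zero)
  -- The approximants `z₂ ^ (-k) * v` of `x` need not be unit vectors, so the normalised Rayleigh
  -- quotient is used.
  have hcont : ContinuousAt (fun y : lp (fun _ : ℕ × ℤ => ℂ) 2 =>
      inner ℂ y (extendedMulZ1 y) / ((‖y‖ ^ 2 : ℝ) : ℂ)) x := by
    refine ContinuousAt.div ?_ (by fun_prop) (by simp [hx1])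
    exact (continuous_id.inner extendedMulZ1.continuous).continuousAt
  have hfreq := (mem_closure_iff_frequently.1 (hS.shiftEmbed_mem_closure hΘ hT hh)).and_eventually
    (isOpen_ne.mem_nhds hx0)
  have hval : inner ℂ x (extendedMulZ1 x) / ((‖x‖ ^ 2 : ℝ) : ℂ) = inner ℂ h (H2.mulZ1 h) := by
    rw [hx1, hx, extendedMulZ1_shiftEmbed, LinearIsometry.inner_map_map]
    simp
  rw [← hval, mem_closure_iff_frequently]
  refine hcont.tendsto.frequently (hfreq.mono ?_)
  rintro _ ⟨⟨k, v, hv, rfl⟩, hv0⟩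
  have hv0' : v ≠ 0 := by
    rintro rfl
    exact hv0 (map_zero _)
  have hn : ‖v‖ ≠ 0 := norm_ne_zero_iff.2 hv0'
  refine mem_numericalRange_compression.2
    ⟨((‖v‖ : ℂ)⁻¹) • v, T₂.toSubmodule.smul_mem _ hv, ?_, ?_⟩
  · rw [norm_smul, norm_inv, Complex.norm_real, norm_norm, inv_mul_cancel₀ hn]
  · rw [extendedMulZ1_shiftEmbed, LinearIsometry.inner_map_map, LinearIsometry.norm_map, map_smul,
      inner_smul_left, inner_smul_right, map_inv₀, Complex.conj_ofReal]
    push_cast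
    have : (‖v‖ : ℂ) ≠ 0 := by exact_mod_cast hn
    field_simp

end Decomposition

end BidiskShift

theorem corollary3p5 (Θ : ℂ × ℂ → ℂ) (hΘ : BidiskShift.IsRationalInner Θ)
    (S₁ S₂ T₁ T₂ : ClosedSubmodule ℂ BidiskShift.H2)
    (hS : BidiskShift.IsShiftDecomposition Θ S₁ S₂)
    (hT : BidiskShift.IsShiftDecomposition Θ T₁ T₂) :
    closure (BidiskShift.numericalRange (BidiskShift.compression BidiskShift.H2.mulZ1 S₂)) =
      closure (BidiskShift.numericalRange (BidiskShift.compression BidiskShift.H2.mulZ1 T₂)) := by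
  exact (closure_minimal (hS.numericalRange_subset hΘ hT) isClosed_closure).antisymm
    (closure_minimal (hT.numericalRange_subset hΘ hS) isClosed_closure)
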